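/- Let $\mathbb F$ be a field, $0\neq q\in\mathbb F$, $d\ge 2$ an integer, and $V$ a vector space over $\mathbb F$ of dimension $d+1$. Rows and columns of matrices in $\mathrm{Mat}_{d+1}(\mathbb F)$ are indexed by $0,\dots,d$. Definitions. * Let $[n]=1+q+\dots+q^{n-1}$, $[n]!=[1][2]\cdots[n]$, and for $0\le k\le n$ let $\binom{n}{k}_q=\frac{[n]!}{[k]!\,[n-k]!}$; this is a polynomial in $q$ with integer coefficients, evaluated at the given $q$. For $k>n$ put $\binom nk_q=0$. * For $A\in\mathrm{Mat}_{d+1}(\mathbb F)$ and $0\le i\le j\le d$ let $A[i,j]$ be the submatrix $(A_{kl})_{0\le k\le j-i,\ i\le l\le j}$. Call $A$ very good if $A[i,j]$ is invertible for all $0\le i\le j\le d$. A very good upper triangular matrix $A$ is nice if $A_{0i}=A_{ii}=1$ for $0\le i\le d$. * A location is a triple $(r,s,t)$ of natural numbers with $r+s+t=d$. A line is the set of all locations with a given value of one given coordinate. A black 3-clique consists of $(r+1,s,t),(r,s+1,t),(r,s,t+1)$, where $r,s,t\in\mathbb N$, $r+s+t=d-1$. A white 3-clique consists of $(r,s+1,t+1),(r+1,s,t+1),(r+1,s+1,t)$,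 where $r,s,t\in\mathbb N$, $r+s+t=d-2$; this is its clockwise order. A Billiard Array on $V$ is a function $\lambda\mapsto B_\lambda$ from the locations to the one-dimensional subspaces of $V$ such that $\sum_{\lambda\in L}B_\lambda$ is direct for each line $L$ and $\sum_{\lambda\in C}B_\lambda$ is not direct for each black 3-clique $C$. Two Billiard Arrays $B,B'$ on $V$ are isomorphic if some linear bijection $\sigma:V\to V$ satisfies $\sigma(B_\lambda)=B'_\lambda$ for all $\lambda$. * Two distinct locations $\lambda,\mu$ in a common black 3-clique $\{\lambda,\mu,\nu\}$ determine $\nu$, and there is a unique linear bijection $\widetilde B_{\lambda,\mu}:B_\lambda\to B_\mu$ such that $x+\widetilde B_{\lambda,\mu}(x)\in B_\nu$ for all $x\in B_\lambda$. The $B$-value of a white 3-clique with locations $\lambda,\mu,\nu$ in clockwise order is the scalar $c\in\mathbb F$ such that $\widetilde B_{\nu,\lambda}\widetilde B_{\mu,\nu}\widetilde B_{\lambda,\mu}=c\cdot\mathrm{id}$ on $B_\lambda$. * Let $A$ be very good and upper triangular. Choose bases $u_0,\dots,u_d$ and $v_0,\dots,v_d$ of $V$ with $v_j=\sum_i A_{ij}u_i$,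 and put $U_i=\mathrm{span}(u_0,\dots,u_i)$, $U_i'=\mathrm{span}(u_d,\dots,u_{d-i})$, $U_i''=\mathrm{span}(v_d,\dots,v_{d-i})$. The assignment $(r,s,t)\mapsto U_{d-r}\cap U'_{d-s}\cap U''_{d-t}$ is a Billiard Array on $V$. The set of Billiard Arrays on $V$ isomorphic to one obtained in this way is denoted $b(A)$; it is nonempty and is a single isomorphism class. Statement. Let $T\in\mathrm{Mat}_{d+1}(\mathbb F)$ be the upper triangular matrix with $T_{ij}=\binom{j}{i}_q$. Then: 1. $\det T[i,j]=q^{\,i(j-i)(j-i+1)/2}$ for $0\le i\le j\le d$. 2. $T$ is very good (and upper triangular), and $T$ is nice. 3. For each $B\in b(T)$, the $B$-value of every white 3-clique is $q^{-1}$. 4. $T$ is the unique nice very good upper triangular matrix with the property in 3: $b(A)\ne\emptyset$ for every very good upper triangular $A$, and if $A$ is moreover nice and some $B\in b(A)$ has all its $B$-values equal to $q^{-1}$, then $A=T$. -/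

import Mathlib

open Polynomial

/-! ## Locations and cliques -/

/-- The triangular array of locations `(r, s, t)` of natural numbers with `r + s + t = d`.
The coordinates `1, 2, 3` of the literature are indexed here by `0, 1, 2`. -/
def Location (d : ℕ) : Type := {x : Fin 3 → ℕ // ∑ i, x i = d}

/-- A black 3-clique: the three locations `(r+1,s,t)`, `(r,s+1,t)`, `(r,s,t+1)`,
where `base = (r,s,t)` and `r + s + t + 1 = d`. -/
structure BlackClique (d : ℕ) where
  base : Fin 3 → ℕ
  sum_base : ∑ i, base i + 1 = d

/-- The location of a black 3-clique obtained from the base by adding `1` to coordinate `i`. -/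
def BlackClique.loc {d : ℕ} (C : BlackClique d) (i : Fin 3) : Location d :=
  ⟨fun j => if j = i then C.base j + 1 else C.base j, by
    have h := C.sum_base
    rw [Fin.sum_univ_three] at h ⊢
    fin_cases i <;> simp <;> omega⟩

/-- A white 3-clique: the three locations `(r,s+1,t+1)`, `(r+1,s,t+1)`, `(r+1,s+1,t)`,
where `base = (r,s,t)` and `r + s + t + 2 = d`. -/
structure WhiteClique (d : ℕ) where
  base : Fin 3 → ℕ
  sum_base : ∑ i, base i + 2 = d

/-- The location of a white 3-clique obtained from the base by adding `1` to every coordinate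
except coordinate `i`. In the standard picture (the corners `(d,0,0)`, `(0,d,0)`, `(0,0,d)` at the
lower left, the top and the lower right) the sequence `loc 0, loc 1, loc 2`, that is
`(r,s+1,t+1), (r+1,s,t+1), (r+1,s+1,t)`, runs clockwise. -/
def WhiteClique.loc {d : ℕ} (C : WhiteClique d) (i : Fin 3) : Location d :=
  ⟨fun j => if j = i then C.base j else C.base j + 1, by
    have h := C.sum_base
    rw [Fin.sum_univ_three] at h ⊢
    fin_cases i <;> simp <;> omega⟩

/-- The locations `l, m, n` are the three members, in some order, of a black 3-clique.
Thus `l, m` form an edge and `n` is the completion of this edge. -/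
def FormBlackClique {d : ℕ} (l m n : Location d) : Prop :=
  ∃ (C : BlackClique d) (σ : Equiv.Perm (Fin 3)),
    C.loc (σ 0) = l ∧ C.loc (σ 1) = m ∧ C.loc (σ 2) = n

/-! ## Billiard Arrays -/

/-- A Billiard Array of diameter `d` on `V` (which is meant to have dimension `d + 1`):
a function from the locations to the one-dimensional subspaces of `V`, such that the sum
along each line (the locations with a given `η`-coordinate `c`) is direct, and
the sum over each black 3-clique is not direct. -/
structure BilliardArray (F : Type*) [Field F] (d : ℕ) (V : Type*) [AddCommGroup V]
    [Module F V] where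
  space : Location d → Submodule F V
  finrank_space : ∀ l, Module.finrank F (space l) = 1
  direct_line : ∀ (η : Fin 3) (c : ℕ),
    iSupIndep (fun l : {l : Location d // l.1 η = c} => space l.1)
  not_direct_black : ∀ C : BlackClique d, ¬ iSupIndep (fun i : Fin 3 => space (C.loc i))

namespace BilliardArray

variable {F : Type*} [Field F] {d : ℕ} {V : Type*} [AddCommGroup V] [Module F V]
  {W : Type*} [AddCommGroup W] [Module F W]

/-- Billiard Arrays are isomorphic if a linear bijection of the underlying vector spaces carries
one to the other. -/
def Isomorphic (B : BilliardArray F d V) (B' : BilliardArray F d W) : Prop :=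
  ∃ σ : V ≃ₗ[F] W, ∀ l, (B.space l).map σ.toLinearMap = B'.space l

/-- The nonzero vectors `u` in `B l` and `v` in `B m` form a brace of the edge `l, m`:
their sum lies in `B n`, where `n` is the completion of the edge. The linear bijection
from `B l` to `B m` attached to adjacent locations is the one that sends `u` to `v` for each
brace `u, v`. -/
def IsBrace (B : BilliardArray F d V) (l m : Location d) (u v : V) : Prop :=
  u ∈ B.space l ∧ v ∈ B.space m ∧ u ≠ 0 ∧ v ≠ 0 ∧
    ∃ n, FormBlackClique l m n ∧ u + v ∈ B.space n

/-- The scalar `c` is a clockwise value of the white 3-clique `C`: going once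
around the clique `λ → μ → ν → λ` clockwise by means of braces multiplies by `c`. -/
def IsBValue (B : BilliardArray F d V) (C : WhiteClique d) (c : F) : Prop :=
  ∀ x y z w : V, B.IsBrace (C.loc 0) (C.loc 1) x y → B.IsBrace (C.loc 1) (C.loc 2) y z →
    B.IsBrace (C.loc 2) (C.loc 0) z w → w = c • x

theorem exists_space_eq_span (B : BilliardArray F d V) (l : Location d) :
    ∃ v : V, v ≠ 0 ∧ B.space l = Submodule.span F {v} := by
  obtain ⟨v, hv, h⟩ := finrank_eq_one_iff'.1 (B.finrank_space l)
  refine ⟨v, by simpa using hv, le_antisymm (fun x hx => ?_) ?_⟩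
  · obtain ⟨c, hc⟩ := h ⟨x, hx⟩
    exact Submodule.mem_span_singleton.2 ⟨c, by simpa using congrArg Subtype.val hc⟩
  · simp

theorem disjoint_loc (B : BilliardArray F d V) (C : BlackClique d) {i j : Fin 3} (hij : i ≠ j) :
    Disjoint (B.space (C.loc i)) (B.space (C.loc j)) := by
  obtain ⟨k, hki, hkj⟩ : ∃ k : Fin 3, k ≠ i ∧ k ≠ j := by
    revert i j; decide
  have h := B.direct_line k (C.base k)
  have := h.pairwiseDisjoint (i := ⟨C.loc i, by simp [BlackClique.loc, hki]⟩)
    (j := ⟨C.loc j, by simp [BlackClique.loc, hkj]⟩) (by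
      intro e
      have e1 := congrFun (congrArg (fun t => t.1.1) e) i
      simp [BlackClique.loc, hij] at e1)
  exact this

theorem formBlackClique_unique {l m n n' : Location d} (h : FormBlackClique l m n)
    (h' : FormBlackClique l m n') : n = n' := by
  have key : ∀ n : Location d, FormBlackClique l m n →
      ∀ a, n.1 a + l.1 a + m.1 a = 3 * min (l.1 a) (m.1 a) + 1 := by
    rintro n ⟨C, σ, rfl, rfl, rfl⟩ a
    have h01 : σ 0 ≠ σ 1 := by simp
    have h02 : σ 0 ≠ σ 2 := by simp
    have h12 : σ 1 ≠ σ 2 := by simp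
    have : a = σ 0 ∨ a = σ 1 ∨ a = σ 2 := by
      revert h01 h02 h12
      generalize σ 0 = x
      generalize σ 1 = y
      generalize σ 2 = z
      revert a x y z; decide
    rcases this with rfl | rfl | rfl <;> simp [BlackClique.loc] <;> omega
  apply Subtype.ext
  funext a
  have := key n h a
  have := key n' h' a
  omega

theorem existsUnique_brace (B : BilliardArray F d V) {l m n : Location d}
    (h : FormBlackClique l m n) {u : V} (hu : u ∈ B.space l) (hu0 : u ≠ 0) :
    ∃! v, B.IsBrace l m u v := by
  have hd : Disjoint (B.space l) (B.space m) ∧ Disjoint (B.space l) (B.space n) ∧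
      Disjoint (B.space m) (B.space n) := by
    obtain ⟨C, σ, rfl, rfl, rfl⟩ := h
    exact ⟨B.disjoint_loc C (by simp), B.disjoint_loc C (by simp), B.disjoint_loc C (by simp)⟩
  obtain ⟨hlm, hln, hmn⟩ := hd
  have hdep : u ∈ B.space m ⊔ B.space n := by
    obtain ⟨a, b, c, ha, hb, hc, habc, hne⟩ : ∃ a b c : V, a ∈ B.space l ∧ b ∈ B.space m ∧
        c ∈ B.space n ∧ a + b + c = 0 ∧ ¬ (a = 0 ∧ b = 0 ∧ c = 0) := by
      obtain ⟨C, σ, rfl, rfl, rfl⟩ := h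
      by_contra hcon
      apply B.not_direct_black C
      rw [iSupIndep_iff_finsetSum_eq_zero_imp_eq_zero]
      intro s v hv hsum i hi
      let w : Fin 3 → V := fun i => if i ∈ s then v i else 0
      have hw : ∀ i, w i ∈ B.space (C.loc i) := by
        intro i
        by_cases his : i ∈ s
        · simpa [w, his] using hv i his
        · simp [w, his]
      have hw0 : w (σ 0) + w (σ 1) + w (σ 2) = 0 := by
        rw [← Fin.sum_univ_three (fun i => w (σ i)), Equiv.sum_comp σ w]
        simpa [w] using hsum
      have hall : w (σ 0) = 0 ∧ w (σ 1) = 0 ∧ w (σ 2) = 0 := by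
        by_contra hn
        exact hcon ⟨_, _, _, hw _, hw _, hw _, hw0, hn⟩
      have hwi : w i = 0 := by
        obtain ⟨j, rfl⟩ := σ.surjective i
        fin_cases j
        · exact hall.1
        · exact hall.2.1
        · exact hall.2.2
      simpa [w, hi] using hwi
    have ha0 : a ≠ 0 := by
      rintro rfl
      apply hne
      rw [zero_add] at habc
      have hbc : b = -c := eq_neg_of_add_eq_zero_left habc
      have hb0 : b = 0 := Submodule.disjoint_def.1 hmn b hb (by rw [hbc]; exact neg_mem hc)
      refine ⟨rfl, hb0, ?_⟩
      rwa [hb0, zero_add] at habc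
    obtain ⟨e, -, he⟩ := B.exists_space_eq_span l
    rw [he] at hu ha
    obtain ⟨p, rfl⟩ := Submodule.mem_span_singleton.1 hu
    obtain ⟨r, rfl⟩ := Submodule.mem_span_singleton.1 ha
    have hr : r ≠ 0 := by
      rintro rfl
      exact ha0 (zero_smul _ _)
    have hsup : r • e ∈ B.space m ⊔ B.space n := by
      have : r • e = -b + -c := by
        rw [← sub_eq_zero, ← habc]; abel
      rw [this]
      exact Submodule.add_mem_sup (neg_mem hb) (neg_mem hc)
    have := Submodule.smul_mem _ (p * r⁻¹) hsup
    rwa [smul_smul, mul_assoc, inv_mul_cancel₀ hr, mul_one] at this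
  obtain ⟨y, hy, z, hz, hyz⟩ := Submodule.mem_sup.1 hdep
  have hy0 : y ≠ 0 := by
    rintro rfl
    apply hu0
    have : u ∈ B.space n := by rw [← hyz]; simpa using hz
    exact Submodule.disjoint_def.1 hln u hu this
  refine ⟨-y, ⟨hu, neg_mem hy, hu0, neg_ne_zero.2 hy0, n, h, ?_⟩, ?_⟩
  · rw [← hyz]; simpa using hz
  · rintro v ⟨-, hv, -, -, n', h', hs⟩
    obtain rfl := formBlackClique_unique h h'
    have h1 : v + y ∈ B.space m := add_mem hv hy
    have h2 : v + y ∈ B.space n := by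
      have : v + y = (u + v) - z := by rw [← hyz]; abel
      rw [this]; exact sub_mem hs hz
    exact eq_neg_of_add_eq_zero_left (Submodule.disjoint_def.1 hmn _ h1 h2)

theorem formBlackClique_white (C : WhiteClique d) {i j k : Fin 3} (hij : i ≠ j) (hik : i ≠ k)
    (hjk : j ≠ k) : ∃ n, FormBlackClique (C.loc i) (C.loc j) n := by
  have hs := C.sum_base
  let D : BlackClique d := ⟨fun a => if a = k then C.base a + 1 else C.base a, by
    rw [Fin.sum_univ_three] at hs ⊢
    fin_cases k <;> simp <;> omega⟩
  have hσ : ∃ σ : Equiv.Perm (Fin 3), σ 0 = j ∧ σ 1 = i ∧ σ 2 = k := by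
    revert i j k; decide
  have hcov : ∀ a, a = i ∨ a = j ∨ a = k := by
    clear_value D; clear hσ hs D
    revert i j k; decide
  obtain ⟨σ, h0, h1, h2⟩ := hσ
  refine ⟨D.loc k, D, σ, ?_, ?_, by rw [h2]⟩
  · rw [h0]; apply Subtype.ext; funext a
    rcases hcov a with rfl | rfl | rfl <;> simp [D, WhiteClique.loc, BlackClique.loc, *, Ne.symm]
  · rw [h1]; apply Subtype.ext; funext a
    rcases hcov a with rfl | rfl | rfl <;> simp [D, WhiteClique.loc, BlackClique.loc, *, Ne.symm]

theorem IsBrace.smul {B : BilliardArray F d V} {l m : Location d} {u v : V}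
    (h : B.IsBrace l m u v) {k : F} (hk : k ≠ 0) : B.IsBrace l m (k • u) (k • v) := by
  obtain ⟨h1, h2, h3, h4, n, h5, h6⟩ := h
  exact ⟨Submodule.smul_mem _ _ h1, Submodule.smul_mem _ _ h2, smul_ne_zero hk h3,
    smul_ne_zero hk h4, n, h5, by rw [← smul_add]; exact Submodule.smul_mem _ _ h6⟩

theorem existsUnique_bValue (B : BilliardArray F d V) (C : WhiteClique d) :
    ∃! c : F, B.IsBValue C c := by
  obtain ⟨n1, h1⟩ := formBlackClique_white C (i := 0) (j := 1) (k := 2) (by decide) (by decide)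
    (by decide)
  obtain ⟨n2, h2⟩ := formBlackClique_white C (i := 1) (j := 2) (k := 0) (by decide) (by decide)
    (by decide)
  obtain ⟨n3, h3⟩ := formBlackClique_white C (i := 2) (j := 0) (k := 1) (by decide) (by decide)
    (by decide)
  obtain ⟨x, hx0, hx⟩ := B.exists_space_eq_span (C.loc 0)
  have hxm : x ∈ B.space (C.loc 0) := by rw [hx]; exact Submodule.mem_span_singleton_self x
  obtain ⟨y, hy, -⟩ := B.existsUnique_brace h1 hxm hx0
  obtain ⟨z, hz, -⟩ := B.existsUnique_brace h2 hy.2.1 hy.2.2.2.1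
  obtain ⟨w, hw, -⟩ := B.existsUnique_brace h3 hz.2.1 hz.2.2.2.1
  have hwm := hw.2.1
  rw [hx] at hwm
  obtain ⟨c, rfl⟩ := Submodule.mem_span_singleton.1 hwm
  refine ⟨c, ?_, ?_⟩
  · intro x' y' z' w' hy' hz' hw'
    have hxm' := hy'.1
    rw [hx] at hxm'
    obtain ⟨k, rfl⟩ := Submodule.mem_span_singleton.1 hxm'
    have hk : k ≠ 0 := by
      rintro rfl
      exact hy'.2.2.1 (zero_smul _ _)
    obtain rfl := (B.existsUnique_brace h1 hy'.1 hy'.2.2.1).unique hy' (hy.smul hk)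
    obtain rfl := (B.existsUnique_brace h2 hz'.1 hz'.2.2.1).unique hz' (hz.smul hk)
    rw [(B.existsUnique_brace h3 hw'.1 hw'.2.2.1).unique hw' (hw.smul hk)]
    exact smul_comm _ _ _
  · intro c' hc'
    have := hc' x y z _ hy hz hw
    exact (smul_left_injective F hx0 this).symm

/-- The (clockwise) `B`-value of a white 3-clique. -/
noncomputable def bValue (B : BilliardArray F d V) (C : WhiteClique d) : F :=
  (B.existsUnique_bValue C).choose

end BilliardArray

/-! ## Very good upper triangular matrices and their Billiard Arrays -/

section Matrices

variable {F : Type*} [Field F] {d : ℕ}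

/-- The submatrix `A[i,j]` of `A`, with rows `0, …, j - i` and columns `i, …, j`. -/
def cornerSubmatrix (A : Matrix (Fin (d + 1)) (Fin (d + 1)) F) (i j : ℕ) (hij : i ≤ j)
    (hj : j ≤ d) : Matrix (Fin (j - i + 1)) (Fin (j - i + 1)) F :=
  fun k l => A ⟨k, by omega⟩ ⟨i + l, by omega⟩

/-- A matrix is very good if all its submatrices `A[i,j]`, `0 ≤ i ≤ j ≤ d`, are invertible. -/
def IsVeryGood (A : Matrix (Fin (d + 1)) (Fin (d + 1)) F) : Prop :=
  ∀ (i j : ℕ) (hij : i ≤ j) (hj : j ≤ d), IsUnit (cornerSubmatrix A i j hij hj)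

/-- The set of very good upper triangular matrices. -/
def veryGoodUpper (d : ℕ) (F : Type*) [Field F] : Set (Matrix (Fin (d + 1)) (Fin (d + 1)) F) :=
  {A | A.BlockTriangular id ∧ IsVeryGood A}

/-- The condition `A_{0i} = A_{ii} = 1` for all `i`, which defines the nice matrices among the
very good upper triangular ones. -/
def IsNice (A : Matrix (Fin (d + 1)) (Fin (d + 1)) F) : Prop :=
  ∀ i, A 0 i = 1 ∧ A i i = 1

variable {V : Type*} [AddCommGroup V] [Module F V]

/-- The component `F f_0 + ⋯ + F f_i` of the flag induced by `f_0, …, f_d`. -/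
def inducedFlag (F : Type*) [Field F] {d : ℕ} {V : Type*} [AddCommGroup V] [Module F V]
    (f : Fin (d + 1) → V) (i : ℕ) : Submodule F V :=
  Submodule.span F (f '' {k | (k : ℕ) ≤ i})

/-- The array `B` is built from the bases `u` and `v`: for each location `(r,s,t)`, `B_{(r,s,t)}`
is the intersection of the components `d-r`, `d-s`, `d-t` of the flags induced by
`u_0, …, u_d`, by `u_d, …, u_0` and by `v_d, …, v_0`, respectively. -/
def IsArrayOfBases (u v : Module.Basis (Fin (d + 1)) F V) (B : BilliardArray F d V) : Prop :=
  ∀ l : Location d, B.space l =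
    inducedFlag F u (d - l.1 0) ⊓ inducedFlag F (u ∘ Fin.rev) (d - l.1 1) ⊓
      inducedFlag F (v ∘ Fin.rev) (d - l.1 2)

/-- The isomorphism class of Billiard Arrays (on `V`) associated with the matrix `A`: view `A` as
the transition matrix from a basis `u` of `V` to a basis `v` of `V`, so that
`v_j = ∑ i, A_{ij} u_i`, and take all Billiard Arrays isomorphic to the one built from `u, v`. -/
def arrayClass (A : Matrix (Fin (d + 1)) (Fin (d + 1)) F) (V : Type*) [AddCommGroup V]
    [Module F V] : Set (BilliardArray F d V) :=
  {B | ∃ (u v : Module.Basis (Fin (d + 1)) F V) (B₀ : BilliardArray F d V),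
    (∀ j, v j = ∑ i, A i j • u i) ∧ IsArrayOfBases u v B₀ ∧ B₀.Isomorphic B}

end Matrices

/-! ## The matrix of `q`-binomial coefficients -/

/-- The `q`-factorial `[n]! = [1][2]⋯[n]`, `[i] = 1 + q + ⋯ + q^{i-1}`, as a polynomial in `q`. -/
noncomputable def qFactorialPoly (n : ℕ) : ℤ[X] :=
  ∏ i ∈ Finset.Icc 1 n, ∑ j ∈ Finset.range i, X ^ j

theorem qFactorialPoly_succ (n : ℕ) :
    qFactorialPoly (n + 1) = qFactorialPoly n * ∑ j ∈ Finset.range (n + 1), X ^ j :=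
  Finset.prod_Icc_succ_top (by omega) _

theorem qFactorialPoly_monic (n : ℕ) : (qFactorialPoly n).Monic :=
  monic_prod_of_monic _ _ fun i hi => monic_geom_sum_X (by have := Finset.mem_Icc.1 hi; omega)

theorem qFactorialPoly_mul_dvd (a b : ℕ) :
    qFactorialPoly a * qFactorialPoly b ∣ qFactorialPoly (a + b) := by
  obtain ⟨n, hn⟩ : ∃ n, n = a + b := ⟨_, rfl⟩
  induction n generalizing a b with
  | zero =>
    obtain ⟨rfl, rfl⟩ : a = 0 ∧ b = 0 := by omega
    simp [qFactorialPoly]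
  | succ n ih =>
    rcases a with - | a
    · simp [qFactorialPoly]
    rcases b with - | b
    · simp [qFactorialPoly]
    obtain ⟨P, hP⟩ := ih a (b + 1) (by omega)
    obtain ⟨Q, hQ⟩ := ih (a + 1) b (by omega)
    rw [show a + (b + 1) = a + b + 1 by omega] at hP
    rw [show a + 1 + b = a + b + 1 by omega] at hQ
    refine ⟨P + X ^ (a + 1) * Q, ?_⟩
    have hsum : ∑ j ∈ Finset.range (a + b + 1 + 1), (X : ℤ[X]) ^ j =
        ∑ j ∈ Finset.range (a + 1), X ^ j +
          X ^ (a + 1) * ∑ j ∈ Finset.range (b + 1), X ^ j := by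
      rw [show a + b + 1 + 1 = (a + 1) + (b + 1) by omega, Finset.sum_range_add, Finset.mul_sum]
      simp only [pow_add]
    rw [show a + 1 + (b + 1) = a + b + 1 + 1 by omega, qFactorialPoly_succ (a + b + 1), hsum,
      mul_add]
    conv_lhs =>
      congr
      · rw [hP]
      · rw [hQ]
    rw [qFactorialPoly_succ a, qFactorialPoly_succ b]
    ring

/-- The `q`-binomial coefficient `[n]! / ([k]! [n-k]!)` for `k ≤ n`, a polynomial in `q`
(the divisor is monic and the division is exact), and `0` for `k > n`. -/
noncomputable def qBinomialPoly (n k : ℕ) : ℤ[X] :=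
  if k ≤ n then qFactorialPoly n /ₘ (qFactorialPoly k * qFactorialPoly (n - k)) else 0

/-- The division in the definition of the `q`-binomial coefficient is exact. -/
theorem mul_qBinomialPoly {n k : ℕ} (h : k ≤ n) :
    qFactorialPoly k * qFactorialPoly (n - k) * qBinomialPoly n k = qFactorialPoly n := by
  have hd := qFactorialPoly_mul_dvd k (n - k)
  rw [Nat.add_sub_cancel' h] at hd
  have hm := (qFactorialPoly_monic k).mul (qFactorialPoly_monic (n - k))
  have h1 := modByMonic_add_div (qFactorialPoly n)
    (qFactorialPoly k * qFactorialPoly (n - k))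
  rw [(modByMonic_eq_zero_iff_dvd hm).2 hd, zero_add] at h1
  rw [qBinomialPoly, if_pos h, h1]

/-- The value of the `q`-binomial coefficient at an element `q` of a field. -/
noncomputable def qBinomial {F : Type*} [Field F] (q : F) (n k : ℕ) : F :=
  aeval q (qBinomialPoly n k)

/-- The upper triangular matrix with entries `T_{ij} = [j choose i]_q`. -/
noncomputable def qBinomialMatrix {F : Type*} [Field F] (q : F) (d : ℕ) :
    Matrix (Fin (d + 1)) (Fin (d + 1)) F :=
  Matrix.of fun i j => qBinomial q (j : ℕ) (i : ℕ)

/-! Determinants. The identity `qBinomial_pascal'` says that moving the window `T[i,j]` one column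
to the right multiplies it on the left by a bidiagonal matrix with diagonal `1, q, …, q^n`. At `i =
0` the window is unitriangular, so the determinant is a power of `q`.

Arrays. In coordinates with respect to `v`, the space at `(r,s,t)` consists of the vectors supported
on `t, …, t+s` whose image under `A` vanishes in rows `0, …, s-1` (`mem_flagSpace_iff`). Very
goodness makes this a line with a unique vector `x s t` having coordinate `1` at `t`, and gives
relations `x (s+1) t = x s t + β s t • x s (t+1)` with `β s t ≠ 0`. These relations are the linear
dependences on black cliques, and the value of the white clique with base `(r,s,t)` is `β (s+1) t /
β s t`.

Values `q⁻¹`. For a nice matrix, the top row of ones forces `β 0 t = -1`, so all values are `q⁻¹`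
exactly when `β s t = -q⁻ˢ`. Then the `x s t` are the twisted iterated differences `qDiff` of the
standard basis, independently of `A`. The matrix enters only through the requirement that
differences of order `i+1` annihilate row `i`. The row `n ↦ [n choose i]_q` satisfies this: its
difference of order `i` is a multiple of `t ↦ q^{it}`, which the next step kills
(`qDiff_qBinomial_of_lt`). Conversely, annihilation is a linear recurrence with nonzero leading
coefficient, so it determines row `i` from its entries up to the diagonal, and these are fixed by
triangularity and niceness (`eq_zero_of_qDiff_eq_zero`). -/

/-! ### Pascal identities for `q`-binomial coefficients -/

theorem qBinomialPoly_eq_zero {n k : ℕ} (h : n < k) : qBinomialPoly n k = 0 :=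
  if_neg (by omega)

theorem qFactorialPoly_zero : qFactorialPoly 0 = 1 := by simp [qFactorialPoly]

theorem qBinomialPoly_zero_right (n : ℕ) : qBinomialPoly n 0 = 1 := by
  have h := mul_qBinomialPoly (Nat.zero_le n)
  rw [qFactorialPoly_zero, one_mul, Nat.sub_zero] at h
  exact mul_left_cancel₀ (qFactorialPoly_monic n).ne_zero (by rw [h, mul_one])

theorem qBinomialPoly_self (n : ℕ) : qBinomialPoly n n = 1 := by
  have h := mul_qBinomialPoly (le_refl n)
  rw [Nat.sub_self, qFactorialPoly_zero, mul_one] at h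
  exact mul_left_cancel₀ (qFactorialPoly_monic n).ne_zero (by rw [h, mul_one])

/-- Multiplying the three terms of the Pascal identities by a common factorial denominator. -/
theorem qFactorialPoly_mul_qBinomialPoly (k m : ℕ) :
    qFactorialPoly (k + 1) * qFactorialPoly (m + 1) * qBinomialPoly (k + m + 1 + 1) (k + 1) =
        qFactorialPoly (k + m + 1) * ∑ j ∈ Finset.range (k + m + 1 + 1), X ^ j ∧
      qFactorialPoly (k + 1) * qFactorialPoly (m + 1) * qBinomialPoly (k + m + 1) (k + 1) =
        qFactorialPoly (k + m + 1) * ∑ j ∈ Finset.range (m + 1), X ^ j ∧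
      qFactorialPoly (k + 1) * qFactorialPoly (m + 1) * qBinomialPoly (k + m + 1) k =
        qFactorialPoly (k + m + 1) * ∑ j ∈ Finset.range (k + 1), X ^ j := by
  refine ⟨?_, ?_, ?_⟩
  · have h := mul_qBinomialPoly (n := k + m + 1 + 1) (k := k + 1) (by omega)
    rw [show k + m + 1 + 1 - (k + 1) = m + 1 by omega] at h
    rw [h, qFactorialPoly_succ]
  · have h := mul_qBinomialPoly (n := k + m + 1) (k := k + 1) (by omega)
    rw [show k + m + 1 - (k + 1) = m by omega] at h
    rw [← h, qFactorialPoly_succ m]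
    ring
  · have h := mul_qBinomialPoly (n := k + m + 1) (k := k) (by omega)
    rw [show k + m + 1 - k = m + 1 by omega] at h
    rw [← h, qFactorialPoly_succ k]
    ring

theorem geom_sum_X_add (a b : ℕ) :
    ∑ j ∈ Finset.range (a + b), (X : ℤ[X]) ^ j =
      ∑ j ∈ Finset.range a, X ^ j + X ^ a * ∑ j ∈ Finset.range b, X ^ j := by
  rw [Finset.sum_range_add, Finset.mul_sum]
  simp only [pow_add]

/-- Once factorials are cleared, this is `[n+1] = [n-k] + q^(n-k) [k+1]`; the companion identity
below comes from splitting `[n+1]` in the other order. For `n < k` the truncated exponent is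
harmless, as its cofactor is `0`. -/
theorem qBinomialPoly_pascal (n k : ℕ) :
    qBinomialPoly (n + 1) (k + 1) = qBinomialPoly n (k + 1) + X ^ (n - k) * qBinomialPoly n k := by
  rcases lt_trichotomy n k with h | rfl | h
  · simp [qBinomialPoly_eq_zero, h, show n < k + 1 by omega]
  · simp [qBinomialPoly_eq_zero, qBinomialPoly_self]
  · obtain ⟨m, rfl⟩ := Nat.exists_eq_add_of_lt h
    obtain ⟨h1, h2, h3⟩ := qFactorialPoly_mul_qBinomialPoly k m
    refine mul_left_cancel₀ ((qFactorialPoly_monic (k + 1)).mul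
      (qFactorialPoly_monic (m + 1))).ne_zero ?_
    rw [mul_add, mul_left_comm _ (X ^ _), h1, h2, h3, show k + m + 1 - k = m + 1 by omega,
      show k + m + 1 + 1 = (m + 1) + (k + 1) by omega, geom_sum_X_add]
    ring

theorem qBinomialPoly_pascal' (n k : ℕ) :
    qBinomialPoly (n + 1) (k + 1) = X ^ (k + 1) * qBinomialPoly n (k + 1) + qBinomialPoly n k := by
  rcases lt_trichotomy n k with h | rfl | h
  · simp [qBinomialPoly_eq_zero, h, show n < k + 1 by omega]
  · simp [qBinomialPoly_eq_zero, qBinomialPoly_self]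
  · obtain ⟨m, rfl⟩ := Nat.exists_eq_add_of_lt h
    obtain ⟨h1, h2, h3⟩ := qFactorialPoly_mul_qBinomialPoly k m
    refine mul_left_cancel₀ ((qFactorialPoly_monic (k + 1)).mul
      (qFactorialPoly_monic (m + 1))).ne_zero ?_
    rw [mul_add, mul_left_comm _ (X ^ _), h1, h2, h3,
      show k + m + 1 + 1 = (k + 1) + (m + 1) by omega, geom_sum_X_add]
    ring

section

variable {F : Type*} [Field F] (q : F)

theorem qBinomial_eq_zero {n k : ℕ} (h : n < k) : qBinomial q n k = 0 := by
  simp [qBinomial, qBinomialPoly_eq_zero h]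

theorem qBinomial_zero_right (n : ℕ) : qBinomial q n 0 = 1 := by
  simp [qBinomial, qBinomialPoly_zero_right]

theorem qBinomial_self (n : ℕ) : qBinomial q n n = 1 := by
  simp [qBinomial, qBinomialPoly_self]

theorem qBinomial_pascal (n k : ℕ) :
    qBinomial q (n + 1) (k + 1) = qBinomial q n (k + 1) + q ^ (n - k) * qBinomial q n k := by
  simp [qBinomial, qBinomialPoly_pascal]

theorem qBinomial_pascal' (n k : ℕ) :
    qBinomial q (n + 1) (k + 1) = q ^ (k + 1) * qBinomial q n (k + 1) + qBinomial q n k := by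
  simp [qBinomial, qBinomialPoly_pascal']

/-! ### The determinants of windows of `q`-binomial coefficients -/

/-- The matrix with rows `0, …, n` and columns `i, …, i + n` of `q`-binomial coefficients. -/
noncomputable def qBinomialWindow (i n : ℕ) : Matrix (Fin (n + 1)) (Fin (n + 1)) F :=
  Matrix.of fun k l => qBinomial q (i + l) k

/-- The lower bidiagonal matrix which shifts a window of `q`-binomial coefficients. -/
def qShiftMatrix (n : ℕ) : Matrix (Fin (n + 1)) (Fin (n + 1)) F :=
  Matrix.of fun k m => if m = k then q ^ (k : ℕ) else if (m : ℕ) + 1 = k then 1 else 0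

/-- Row `k` of the product is `q^k` times row `k` plus row `k - 1`, which is `qBinomial_pascal'`. -/
theorem qBinomialWindow_succ (i n : ℕ) :
    qBinomialWindow q (i + 1) n = qShiftMatrix q n * qBinomialWindow q i n := by
  ext k l
  simp only [qBinomialWindow, qShiftMatrix, Matrix.mul_apply, Matrix.of_apply]
  obtain ⟨k, hk⟩ := k
  rcases k with - | k
  · rw [Finset.sum_eq_single ⟨0, hk⟩]
    · simp [qBinomial_zero_right]
    · intro b _ hb
      rw [if_neg hb, if_neg (Nat.succ_ne_zero _), zero_mul]
    · simp
  · rw [Finset.sum_eq_add ⟨k + 1, hk⟩ ⟨k, by omega⟩ (by rw [Ne, Fin.mk.injEq]; omega)]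
    · simp [show i + 1 + (l : ℕ) = i + l + 1 by omega, qBinomial_pascal']
    · rintro b - ⟨hb, hb'⟩
      have : (b : ℕ) + 1 ≠ k + 1 := fun h => hb' (Fin.ext (by simpa using h))
      rw [if_neg hb, if_neg this, zero_mul]
    · simp
    · simp

theorem det_qShiftMatrix (n : ℕ) : (qShiftMatrix q n).det = q ^ (n * (n + 1) / 2) := by
  rw [Matrix.det_of_isLowerTriangular]
  · simp only [qShiftMatrix, Matrix.of_apply, if_true]
    rw [Finset.prod_pow_eq_pow_sum, Fin.sum_univ_eq_sum_range (fun k => k), Finset.sum_range_id]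
    simp [mul_comm]
  · intro a b hab
    have h : (a : ℕ) < b := hab
    simp only [qShiftMatrix, Matrix.of_apply]
    rw [if_neg (by rintro rfl; omega), if_neg (by omega)]

theorem det_qBinomialWindow (i n : ℕ) :
    (qBinomialWindow q i n).det = q ^ (i * (n * (n + 1) / 2)) := by
  induction i with
  | zero =>
    rw [Matrix.det_of_isUpperTriangular]
    · simp [qBinomialWindow, qBinomial_self]
    · intro a b hab
      have h : (b : ℕ) < a := hab
      simp [qBinomialWindow, qBinomial_eq_zero q h]
  | succ i ih =>
    rw [qBinomialWindow_succ, Matrix.det_mul, det_qShiftMatrix, ih, ← pow_add]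
    congr 1
    ring

theorem det_cornerSubmatrix_qBinomialMatrix {d i j : ℕ} (hij : i ≤ j) (hj : j ≤ d) :
    (cornerSubmatrix (qBinomialMatrix q d) i j hij hj).det =
      q ^ (i * (j - i) * (j - i + 1) / 2) := by
  have h : cornerSubmatrix (qBinomialMatrix q d) i j hij hj = qBinomialWindow q i (j - i) := rfl
  -- The two natural-number divisions agree because `(j-i)(j-i+1)` is even.
  rw [h, det_qBinomialWindow, mul_assoc, Nat.mul_div_assoc _ (Nat.even_mul_succ_self _).two_dvd]

theorem qBinomialMatrix_mem_veryGoodUpper (hq : q ≠ 0) (d : ℕ) :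
    qBinomialMatrix q d ∈ veryGoodUpper d F := by
  refine ⟨fun a b hab => qBinomial_eq_zero q hab, fun i j hij hj => ?_⟩
  rw [Matrix.isUnit_iff_isUnit_det, det_cornerSubmatrix_qBinomialMatrix]
  exact (pow_ne_zero _ hq).isUnit

theorem isNice_qBinomialMatrix (d : ℕ) : IsNice (qBinomialMatrix q d) :=
  fun i => ⟨qBinomial_zero_right q i, qBinomial_self q i⟩

end

/-! ### Twisted iterated differences -/

section

variable {F : Type*} [Field F] (q : F) {M N : Type*} [AddCommGroup M] [Module F M]
  [AddCommGroup N] [Module F N]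

/-- The twisted iterated differences of a sequence `f`: the step from order `s` to order `s + 1`
is `g ↦ (t ↦ g t - q⁻ˢ g (t + 1))`. -/
def qDiff (f : ℕ → M) : ℕ → ℕ → M
  | 0, t => f t
  | s + 1, t => qDiff f s t - (q⁻¹ ^ s) • qDiff f s (t + 1)

/-- Used to read off coordinates, and rows of `A`, from differences of the standard basis. -/
theorem qDiff_map (φ : M →ₗ[F] N) (f : ℕ → M) (s t : ℕ) :
    φ (qDiff q f s t) = qDiff q (fun n => φ (f n)) s t := by
  induction s generalizing t with
  | zero => rfl
  | succ s ih => simp [qDiff, ih]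

theorem qDiff_sub (f g : ℕ → M) (s t : ℕ) :
    qDiff q (fun n => f n - g n) s t = qDiff q f s t - qDiff q g s t := by
  induction s generalizing t with
  | zero => rfl
  | succ s ih => simp only [qDiff, ih, smul_sub]; abel

theorem qDiff_congr {f g : ℕ → M} {s t : ℕ} (h : ∀ n, t ≤ n → n ≤ t + s → f n = g n) :
    qDiff q f s t = qDiff q g s t := by
  induction s generalizing t with
  | zero => exact h t le_rfl le_rfl
  | succ s ih =>
    simp only [qDiff]
    rw [ih fun n h1 h2 => h n h1 (by omega), ih fun n h1 h2 => h n (by omega) (by omega)]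

/-- The coefficient of the last term in the twisted difference of order `s`. -/
def qDiffCoeff (s : ℕ) : F := ∏ j ∈ Finset.range s, -q⁻¹ ^ j

theorem qDiffCoeff_succ (s : ℕ) : qDiffCoeff q (s + 1) = qDiffCoeff q s * -q⁻¹ ^ s :=
  Finset.prod_range_succ _ _

variable {q}

theorem qDiffCoeff_ne_zero (hq : q ≠ 0) (s : ℕ) : qDiffCoeff q s ≠ 0 :=
  Finset.prod_ne_zero_iff.2 fun _ _ => neg_ne_zero.2 (pow_ne_zero _ (inv_ne_zero hq))

/-- The difference involves only `f t, …, f (t + s)`, of which just the last term survives. -/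
theorem qDiff_of_forall_lt {f : ℕ → F} {s t : ℕ} (h : ∀ n < t + s, f n = 0) :
    qDiff q f s t = qDiffCoeff q s * f (t + s) := by
  induction s generalizing t with
  | zero => simp [qDiff, qDiffCoeff]
  | succ s ih =>
    rw [qDiff, ih fun n hn => h n (by omega), ih fun n hn => h n (by omega), h (t + s) (by omega),
      qDiffCoeff_succ, show t + 1 + s = t + (s + 1) by omega, smul_eq_mul]
    ring

/-- A sequence up to `d` is determined by its initial values and a twisted difference. -/
theorem eq_zero_of_qDiff_eq_zero (hq : q ≠ 0) {f : ℕ → F} {s d : ℕ} (h : ∀ n < s, f n = 0)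
    (h' : ∀ t, t + s ≤ d → qDiff q f s t = 0) : ∀ n ≤ d, f n = 0 := by
  intro n
  induction n using Nat.strong_induction_on with
  | _ n ih =>
    intro hn
    rcases lt_or_ge n s with hs | hs
    · exact h n hs
    · have h1 := h' (n - s) (by omega)
      rw [qDiff_of_forall_lt fun m hm => ih m (by omega) (by omega)] at h1
      rw [show n = n - s + s by omega]
      exact (mul_eq_zero.1 h1).resolve_left (qDiffCoeff_ne_zero hq s)

/-- Each step lowers the bottom index by one: after factoring out powers of `q`, it forms `[t choose
j+1] - [t+1 choose j+1]`, which is `-q^(t-j) [t choose j]` by `qBinomial_pascal`. The cases `t ≤ j`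
are separate because the exponents truncate there. -/
theorem qDiff_qBinomial_add (hq : q ≠ 0) (s t j : ℕ) :
    qDiff q (fun n => qBinomial q n (s + j)) s t =
      qDiffCoeff q s * q ^ (s * (t - j)) * qBinomial q t j := by
  induction s generalizing t j with
  | zero => simp [qDiff, qDiffCoeff]
  | succ s ih =>
    simp only [qDiff, show s + 1 + j = s + (j + 1) by omega, ih, smul_eq_mul, qDiffCoeff_succ]
    rcases lt_trichotomy t j with h | rfl | h
    · simp [qBinomial_eq_zero, h, show t < j + 1 by omega]
    · simp [qBinomial_eq_zero, qBinomial_self]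
      ring
    · obtain ⟨m, rfl⟩ := Nat.exists_eq_add_of_lt h
      rw [qBinomial_pascal q (j + m + 1) j, show j + m + 1 + 1 - (j + 1) = m + 1 by omega,
        show j + m + 1 - (j + 1) = m by omega, show j + m + 1 - j = m + 1 by omega,
        show s * (m + 1) = s * m + s by ring, show (s + 1) * (m + 1) = s * m + s + (m + 1) by ring,
        pow_add, pow_add, pow_add, inv_pow]
      field_simp
      ring

theorem qDiff_qBinomial_of_lt (hq : q ≠ 0) {s i : ℕ} (h : i < s) (t : ℕ) :
    qDiff q (fun n => qBinomial q n i) s t = 0 := by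
  induction s generalizing t with
  | zero => omega
  | succ s ih =>
    rcases Nat.lt_succ_iff_lt_or_eq.1 h with h | rfl
    · simp [qDiff, ih h]
    · have h0 := fun t => qDiff_qBinomial_add hq i t 0
      simp only [add_zero, qBinomial_zero_right, Nat.sub_zero, mul_one] at h0
      simp only [qDiff, h0, smul_eq_mul, inv_pow, mul_add, pow_add, mul_one]
      field_simp
      ring

end

/-! ### Very good matrices -/

section

variable {F : Type*} [Field F] {d : ℕ} {A : Matrix (Fin (d + 1)) (Fin (d + 1)) F}

open Matrix

theorem cornerSubmatrix_mulVec {i j : ℕ} (hij : i ≤ j) (hj : j ≤ d) {x : Fin (d + 1) → F}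
    (hx : ∀ k : Fin (d + 1), (k : ℕ) < i ∨ j < k → x k = 0) (k : Fin (j - i + 1)) :
    (cornerSubmatrix A i j hij hj *ᵥ fun l => x ⟨i + l, by omega⟩) k =
      (A *ᵥ x) ⟨k, by omega⟩ := by
  simp only [Matrix.mulVec, dotProduct, cornerSubmatrix]
  refine Finset.sum_of_injOn (fun l => (⟨i + l, by omega⟩ : Fin (d + 1))) ?_ (by simp) ?_
    (fun _ _ => rfl)
  · intro a _ b _ h
    simpa [Fin.ext_iff] using h
  · intro b _ hb
    rw [hx b, mul_zero]
    by_contra! hcon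
    exact hb ⟨⟨b - i, by omega⟩, by simp, Fin.ext (by simp; omega)⟩

/-- Injectivity of `A[i,j]`, phrased for vectors of full length; `IsVeryGood.exists_mulVec_eq` is
the matching surjectivity. -/
theorem IsVeryGood.eq_zero (hA : IsVeryGood A) {i j : ℕ} (hij : i ≤ j) (hj : j ≤ d)
    {x : Fin (d + 1) → F} (hx : ∀ k : Fin (d + 1), (k : ℕ) < i ∨ j < k → x k = 0)
    (h : ∀ k : Fin (d + 1), (k : ℕ) ≤ j - i → (A *ᵥ x) k = 0) : x = 0 := by
  have h1 : (fun l : Fin (j - i + 1) => x ⟨i + l, by omega⟩) = 0 := by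
    apply mulVec_injective_of_isUnit (hA i j hij hj)
    rw [mulVec_zero]
    ext k
    rw [cornerSubmatrix_mulVec hij hj hx]
    exact h _ (by simp; omega)
  ext k
  by_cases hk : (k : ℕ) < i ∨ j < k
  · exact hx k hk
  · have h2 := congrFun h1 ⟨k - i, by omega⟩
    simp only [Pi.zero_apply] at h2 ⊢
    rw [← h2]
    congr
    ext
    simp
    omega

theorem IsVeryGood.exists_mulVec_eq (hA : IsVeryGood A) {i j : ℕ} (hij : i ≤ j) (hj : j ≤ d)
    (w : Fin (d + 1) → F) : ∃ x : Fin (d + 1) → F,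
      (∀ k : Fin (d + 1), (k : ℕ) < i ∨ j < k → x k = 0) ∧
        ∀ k : Fin (d + 1), (k : ℕ) ≤ j - i → (A *ᵥ x) k = w k := by
  let y : Fin (j - i + 1) → F := (cornerSubmatrix A i j hij hj)⁻¹ *ᵥ fun k => w ⟨k, by omega⟩
  let x : Fin (d + 1) → F := fun k => if h : (k : ℕ) < i ∨ j < k then 0 else y ⟨k - i, by omega⟩
  have hx : ∀ k : Fin (d + 1), (k : ℕ) < i ∨ j < k → x k = 0 := fun k h => dif_pos h
  refine ⟨x, hx, fun k hk => ?_⟩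
  have h1 := cornerSubmatrix_mulVec (A := A) hij hj hx ⟨k, by omega⟩
  have h2 : (fun l : Fin (j - i + 1) => x ⟨i + l, by omega⟩) = y := by
    ext l
    simp only [x]
    rw [dif_neg (by omega)]
    congr
    simp
  rw [h2] at h1
  simp only [y] at h1
  rw [mulVec_mulVec, mul_nonsing_inv _ ((isUnit_iff_isUnit_det _).1 (hA i j hij hj)),
    one_mulVec] at h1
  exact h1.symm

theorem IsVeryGood.isUnit (hA : IsVeryGood A) : IsUnit A := by
  refine mulVec_injective_iff_isUnit.1 fun x y hxy => ?_
  rw [← sub_eq_zero]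
  refine hA.eq_zero (Nat.zero_le d) le_rfl (fun k hk => by omega) fun k _ => ?_
  rw [mulVec_sub, sub_eq_zero.2 hxy, Pi.zero_apply]

theorem mulVec_eq_zero_of_blockTriangular (hA : A.BlockTriangular id) {n : ℕ} {x : Fin (d + 1) → F}
    (hx : ∀ k : Fin (d + 1), n < k → x k = 0) (k : Fin (d + 1)) (hk : n < k) :
    (A *ᵥ x) k = 0 := by
  rw [mulVec, dotProduct]
  refine Finset.sum_eq_zero fun l _ => ?_
  rcases lt_or_ge l k with h | h
  · rw [hA h, zero_mul]
  · rw [hx l (lt_of_lt_of_le hk h), mul_zero]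

/-- The inverse of `A` is upper triangular too, so `u` and `v` induce the same flag. -/
theorem forall_mulVec_eq_zero_iff (hA : A ∈ veryGoodUpper d F) {n : ℕ} {x : Fin (d + 1) → F} :
    (∀ k : Fin (d + 1), n < k → (A *ᵥ x) k = 0) ↔ ∀ k : Fin (d + 1), n < k → x k = 0 := by
  refine ⟨fun h => ?_, fun h => mulVec_eq_zero_of_blockTriangular hA.1 h⟩
  have hdet := (isUnit_iff_isUnit_det _).1 hA.2.isUnit
  have : Invertible A := invertibleOfIsUnitDet A hdet
  have h1 := mulVec_eq_zero_of_blockTriangular (blockTriangular_inv_of_blockTriangular hA.1) h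
  rwa [mulVec_mulVec, nonsing_inv_mul _ hdet, one_mulVec] at h1

/-- The vector `x` is supported on `t, …, t + s` and its image under `A` vanishes at
`0, …, s - 1`. -/
def IsWindowVector (A : Matrix (Fin (d + 1)) (Fin (d + 1)) F) (s t : ℕ) (x : Fin (d + 1) → F) :
    Prop :=
  (∀ k : Fin (d + 1), (k : ℕ) < t ∨ t + s < k → x k = 0) ∧
    ∀ i : Fin (d + 1), (i : ℕ) < s → (A *ᵥ x) i = 0

/-- Without its first coordinate, the vector is supported on `s` columns and killed by `s` rows, so
the invertibility of `A[t+1,t+s]` applies. For `s = 0` that submatrix does not exist. The next two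
lemmas use `A[t,t+s-1]` and `A[t,t+s]` in the same way. -/
theorem IsWindowVector.eq_zero (hA : IsVeryGood A) {s t : ℕ} (hst : t + s ≤ d)
    {x : Fin (d + 1) → F} (hx : IsWindowVector A s t x) (h : x ⟨t, by omega⟩ = 0) : x = 0 := by
  rcases s with - | s
  · ext k
    by_cases hk : (k : ℕ) = t
    · rw [show k = ⟨t, by omega⟩ from Fin.ext hk, h, Pi.zero_apply]
    · exact hx.1 k (by omega)
  · refine hA.eq_zero (i := t + 1) (j := t + (s + 1)) (by omega) hst (fun k hk => ?_)
      fun k hk => hx.2 k (by omega)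
    by_cases hkt : (k : ℕ) = t
    · rw [show k = ⟨t, by omega⟩ from Fin.ext hkt, h]
    · exact hx.1 k (by omega)

theorem IsWindowVector.eq_zero_of_last (hA : IsVeryGood A) {s t : ℕ} (hst : t + s ≤ d)
    {x : Fin (d + 1) → F} (hx : IsWindowVector A s t x) (h : x ⟨t + s, by omega⟩ = 0) : x = 0 := by
  rcases s with - | s
  · exact hx.eq_zero hA hst h
  · refine hA.eq_zero (i := t) (j := t + s) (by omega) (by omega) (fun k hk => ?_)
      fun k hk => hx.2 k (by omega)
    by_cases hkt : (k : ℕ) = t + (s + 1)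
    · rw [show k = ⟨t + (s + 1), by omega⟩ from Fin.ext hkt, h]
    · exact hx.1 k (by omega)

theorem IsWindowVector.eq_zero_of_mulVec (hA : IsVeryGood A) {s t : ℕ} (hst : t + s ≤ d)
    {x : Fin (d + 1) → F} (hx : IsWindowVector A s t x) (h : (A *ᵥ x) ⟨s, by omega⟩ = 0) :
    x = 0 := by
  refine hA.eq_zero (i := t) (j := t + s) (by omega) (by omega) hx.1 fun k hk => ?_
  by_cases hks : (k : ℕ) = s
  · rw [show k = ⟨s, by omega⟩ from Fin.ext hks, h]
  · exact hx.2 k (by omega)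

theorem IsVeryGood.exists_isWindowVector (hA : IsVeryGood A) {s t : ℕ} (hst : t + s ≤ d) :
    ∃ x, IsWindowVector A s t x ∧ x ⟨t, by omega⟩ = 1 := by
  rcases s with - | s
  · refine ⟨Pi.single ⟨t, by omega⟩ 1, ⟨fun k hk => ?_, fun i hi => by omega⟩, by simp⟩
    exact Pi.single_eq_of_ne (fun h => by subst h; simp at hk) _
  -- Coordinates beyond `t` are chosen to cancel the image of the basis vector at `t` in the rows
  -- below index `s + 1`.
  · obtain ⟨x, hx, hx'⟩ := hA.exists_mulVec_eq (i := t + 1) (j := t + (s + 1)) (by omega) hst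
      (-(A *ᵥ Pi.single ⟨t, by omega⟩ 1))
    refine ⟨Pi.single ⟨t, by omega⟩ 1 + x, ⟨fun k hk => ?_, fun i hi => ?_⟩, ?_⟩
    · rw [Pi.add_apply, hx k (by omega), add_zero]
      exact Pi.single_eq_of_ne (fun h => by subst h; simp at hk) _
    · rw [mulVec_add, Pi.add_apply, hx' i (by omega)]
      simp
    · rw [Pi.add_apply, hx _ (by simp), Pi.single_eq_same, add_zero]

theorem IsWindowVector.smul {s t : ℕ} {x : Fin (d + 1) → F} (hx : IsWindowVector A s t x) (c : F) :
    IsWindowVector A s t (c • x) :=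
  ⟨fun k hk => by simp [hx.1 k hk], fun i hi => by simp [mulVec_smul, hx.2 i hi]⟩

theorem IsWindowVector.sub {s t : ℕ} {x y : Fin (d + 1) → F} (hx : IsWindowVector A s t x)
    (hy : IsWindowVector A s t y) : IsWindowVector A s t (x - y) :=
  ⟨fun k hk => by simp [hx.1 k hk, hy.1 k hk],
    fun i hi => by simp [mulVec_sub, hx.2 i hi, hy.2 i hi]⟩

theorem IsWindowVector.eq_smul (hA : IsVeryGood A) {s t : ℕ} (hst : t + s ≤ d)
    {x y : Fin (d + 1) → F} (hx : IsWindowVector A s t x) (hx1 : x ⟨t, by omega⟩ = 1)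
    (hy : IsWindowVector A s t y) : y = y ⟨t, by omega⟩ • x := by
  rw [← sub_eq_zero]
  exact (hy.sub (hx.smul _)).eq_zero hA hst (by simp [hx1])

/-- The difference of normalized window vectors of orders `s + 1` and `s` at `t` is a window vector
of order `s` at `t + 1`. -/
theorem IsWindowVector.sub_succ {s t : ℕ} (hst : t + s < d) {x y : Fin (d + 1) → F}
    (hx : IsWindowVector A s t x) (hx1 : x ⟨t, by omega⟩ = 1)
    (hy : IsWindowVector A (s + 1) t y) (hy1 : y ⟨t, by omega⟩ = 1) :
    IsWindowVector A s (t + 1) (y - x) := by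
  refine ⟨fun k hk => ?_, fun i hi => by simp [mulVec_sub, hx.2 i hi, hy.2 i (by omega)]⟩
  by_cases hkt : (k : ℕ) = t
  · rw [show k = ⟨t, by omega⟩ from Fin.ext hkt, Pi.sub_apply, hx1, hy1, sub_self]
  · rw [Pi.sub_apply, hx.1 k (by omega), hy.1 k (by omega), sub_self]

end

/-! ### Window systems and their three-term relations -/

section

variable {F : Type*} [Field F] {d : ℕ} {A : Matrix (Fin (d + 1)) (Fin (d + 1)) F}

open Matrix

/-- A system of window vectors `x s t` of a matrix, normalized to have coordinate `1` at `t`, with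
the three-term relations of coefficients `β s t` between them. -/
structure IsWindowSystem (A : Matrix (Fin (d + 1)) (Fin (d + 1)) F)
    (x : ℕ → ℕ → Fin (d + 1) → F) (β : ℕ → ℕ → F) : Prop where
  isWindowVector : ∀ s t, t + s ≤ d → IsWindowVector A s t (x s t)
  apply_eq_one : ∀ s t (h : t + s ≤ d), x s t ⟨t, by omega⟩ = 1
  coeff_ne_zero : ∀ s t, t + s < d → β s t ≠ 0
  rel : ∀ s t, t + s < d → x (s + 1) t = x s t + β s t • x s (t + 1)

theorem IsVeryGood.exists_isWindowSystem (hA : IsVeryGood A) :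
    ∃ x β, IsWindowSystem A x β := by
  have h : ∀ s t, ∃ x : Fin (d + 1) → F, ∀ h : t + s ≤ d, IsWindowVector A s t x ∧
      x ⟨t, by omega⟩ = 1 := by
    intro s t
    by_cases h : t + s ≤ d
    · obtain ⟨x, hx⟩ := hA.exists_isWindowVector h
      exact ⟨x, fun _ => hx⟩
    · exact ⟨0, fun h' => absurd h' h⟩
  choose x hx using h
  have hβ : ∀ s t, ∃ b : F, t + s < d → b ≠ 0 ∧ x (s + 1) t = x s t + b • x s (t + 1) := by
    intro s t
    by_cases h : t + s < d
    · obtain ⟨h1, h1'⟩ := hx s t (by omega)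
      obtain ⟨h2, h2'⟩ := hx (s + 1) t (by omega)
      obtain ⟨h3, h3'⟩ := hx s (t + 1) (by omega)
      have h4 := h3.eq_smul hA (by omega) h3' (h1.sub_succ h h1' h2 h2')
      refine ⟨_, fun _ => ⟨fun h0 => ?_, eq_add_of_sub_eq' h4⟩⟩
      rw [h0, zero_smul, sub_eq_zero] at h4
      -- If the coefficient were `0`, then `x (s+1) t` would equal `x s t`, which has no coordinate
      -- at its last place `t + s + 1`.
      have h5 := h2.eq_zero_of_last hA h (by rw [h4]; exact h1.1 _ (by simp))
      rw [h5] at h2'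
      exact zero_ne_one h2'
    · exact ⟨0, fun h' => absurd h' h⟩
  choose β hβ using hβ
  exact ⟨x, β, fun s t h => (hx s t h).1, fun s t h => (hx s t h).2, fun s t h => (hβ s t h).1,
    fun s t h => (hβ s t h).2⟩

end

/-! ### Independent families with distinct leading coordinates -/

/-- In a vanishing sum, the nonzero term with the smallest `g i` is the only one that `f (g i)` can
detect. -/
theorem iSupIndep_of_leading {F V ι κ : Type*} [Field F] [AddCommGroup V] [Module F V]
    [LinearOrder κ] (p : ι → Submodule F V) (f : κ → V →ₗ[F] F) (g : ι → κ)
    (hg : Function.Injective g) (hlt : ∀ i, ∀ x ∈ p i, ∀ k < g i, f k x = 0)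
    (hne : ∀ i, ∀ x ∈ p i, f (g i) x = 0 → x = 0) : iSupIndep p := by
  classical
  rw [iSupIndep_iff_finsetSum_eq_zero_imp_eq_zero]
  intro s v hv hsum
  by_contra! hcon
  obtain ⟨i, hi, hmin⟩ := Finset.exists_min_image {i ∈ s | v i ≠ 0} g
    (by obtain ⟨i, hi⟩ := hcon; exact ⟨i, by simpa using hi⟩)
  obtain ⟨his, hi0⟩ := Finset.mem_filter.1 hi
  apply hi0
  apply hne i _ (hv i his)
  have h := congrArg (f (g i)) hsum
  rw [map_sum, map_zero, Finset.sum_eq_single i] at h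
  · exact h
  · intro j hj hji
    by_cases hj0 : v j = 0
    · rw [hj0, map_zero]
    · exact hlt j _ (hv j hj) _ (lt_of_le_of_ne (hmin j (by simp [hj, hj0]))
        fun h => hji (hg h).symm)
  · exact fun h => absurd his h

/-! ### Flags -/

section

variable {F : Type*} [Field F] {d : ℕ} {V : Type*} [AddCommGroup V] [Module F V]

theorem Location.sum_eq (l : Location d) : l.1 0 + l.1 1 + l.1 2 = d := by
  rw [← Fin.sum_univ_three]
  exact l.2

theorem mem_inducedFlag_iff (u : Module.Basis (Fin (d + 1)) F V) (n : ℕ) (x : V) :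
    x ∈ inducedFlag F u n ↔ ∀ k : Fin (d + 1), n < k → u.equivFun x k = 0 := by
  rw [inducedFlag, u.mem_span_image]
  simp only [Set.subset_def, Finset.mem_coe, Finsupp.mem_support_iff, Set.mem_ofPred_eq,
    Module.Basis.equivFun_apply]
  exact forall_congr' fun k => by rw [← not_imp_not, not_not, not_le]

theorem mem_inducedFlag_rev_iff (u : Module.Basis (Fin (d + 1)) F V) {n : ℕ} (hn : n ≤ d) (x : V) :
    x ∈ inducedFlag F (u ∘ Fin.rev) (d - n) ↔
      ∀ k : Fin (d + 1), (k : ℕ) < n → u.equivFun x k = 0 := by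
  have h := mem_inducedFlag_iff (u.reindex Fin.revPerm) (d - n) x
  have h1 : ⇑(u.reindex Fin.revPerm) = u ∘ Fin.rev := by
    ext k
    simp
  rw [h1] at h
  rw [h, ← Fin.revPerm.forall_congr_right]
  refine forall_congr' fun k => ?_
  have hk : d - n < (Fin.revPerm k : Fin (d + 1)) ↔ (k : ℕ) < n := by
    rw [Fin.revPerm_apply, Fin.val_rev]
    omega
  rw [hk]
  simp

variable {A : Matrix (Fin (d + 1)) (Fin (d + 1)) F} {u v : Module.Basis (Fin (d + 1)) F V}

open Matrix

theorem equivFun_eq_mulVec (h : ∀ j, v j = ∑ i, A i j • u i) (x : V) :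
    u.equivFun x = A *ᵥ v.equivFun x := by
  apply u.equivFun.symm.injective
  rw [LinearEquiv.symm_apply_apply, Module.Basis.equivFun_symm_apply]
  conv_lhs => rw [← v.sum_equivFun x]
  simp only [h, mulVec, dotProduct, Finset.smul_sum, Finset.sum_smul, smul_smul]
  rw [Finset.sum_comm]
  exact Finset.sum_congr rfl fun i _ => Finset.sum_congr rfl fun j _ => by rw [mul_comm]

/-- The intersection of components of flags which the array of a pair of bases has at `l`. -/
noncomputable def flagSpace (u v : Module.Basis (Fin (d + 1)) F V) (l : Location d) : Submodule F V :=
  inducedFlag F u (d - l.1 0) ⊓ inducedFlag F (u ∘ Fin.rev) (d - l.1 1) ⊓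
    inducedFlag F (v ∘ Fin.rev) (d - l.1 2)

/-- The three flags bound the support above by `d - r = t + s`, kill the first `s` coordinates over
`u`, and bound the support below by `t`. -/
theorem mem_flagSpace_iff (hA : A ∈ veryGoodUpper d F) (h : ∀ j, v j = ∑ i, A i j • u i)
    (l : Location d) (x : V) :
    x ∈ flagSpace u v l ↔ IsWindowVector A (l.1 1) (l.1 2) (v.equivFun x) := by
  have hl := l.sum_eq
  rw [flagSpace, Submodule.mem_inf, Submodule.mem_inf, mem_inducedFlag_iff,
    mem_inducedFlag_rev_iff u (by omega), mem_inducedFlag_rev_iff v (by omega),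
    equivFun_eq_mulVec h, forall_mulVec_eq_zero_iff hA,
    show d - l.1 0 = l.1 2 + l.1 1 by omega]
  exact ⟨fun ⟨⟨h1, h2⟩, h3⟩ => ⟨fun k hk => hk.elim (h3 k) (h1 k), h2⟩,
    fun ⟨h1, h2⟩ => ⟨⟨fun k hk => h1 k (Or.inr hk), h2⟩, fun k hk => h1 k (Or.inl hk)⟩⟩

theorem BlackClique.sum_eq (C : BlackClique d) : C.base 0 + C.base 1 + C.base 2 + 1 = d := by
  rw [← Fin.sum_univ_three]
  exact C.sum_base

theorem WhiteClique.sum_eq (C : WhiteClique d) : C.base 0 + C.base 1 + C.base 2 + 2 = d := by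
  rw [← Fin.sum_univ_three]
  exact C.sum_base

theorem Location.ext_of_eq {l m : Location d} {η : Fin 3} (h : l.1 η = m.1 η) {θ : Fin 3}
    (hθ : θ ≠ η) (h' : l.1 θ = m.1 θ) : l = m := by
  have hl := l.sum_eq
  have hm := m.sum_eq
  apply Subtype.ext
  funext a
  fin_cases η <;> fin_cases θ <;> fin_cases a <;> simp_all <;> omega

theorem finrank_flagSpace (hA : A ∈ veryGoodUpper d F) (h : ∀ j, v j = ∑ i, A i j • u i)
    (l : Location d) : Module.finrank F (flagSpace u v l) = 1 := by
  have hl := l.sum_eq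
  have hle : l.1 2 + l.1 1 ≤ d := by omega
  obtain ⟨x, hx, hx1⟩ := hA.2.exists_isWindowVector hle
  refine finrank_eq_one_iff'.2 ⟨⟨v.equivFun.symm x, ?_⟩, ?_, ?_⟩
  · rw [mem_flagSpace_iff hA h, LinearEquiv.apply_symm_apply]
    exact hx
  · rw [Ne, Submodule.mk_eq_zero, LinearEquiv.map_eq_zero_iff]
    rintro rfl
    exact zero_ne_one hx1
  · rintro ⟨w, hw⟩
    rw [mem_flagSpace_iff hA h] at hw
    refine ⟨v.equivFun w ⟨l.1 2, by omega⟩, Subtype.ext (v.equivFun.injective ?_)⟩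
    simp only [Submodule.coe_smul, map_smul, LinearEquiv.apply_symm_apply]
    exact (hx.eq_smul hA.2 hle hx1 hw).symm

/-- If `t` varies along the line, the leading coordinate over `v` sits at `t`. If `t` is constant,
then `s` varies and the leading coordinate over `u` sits at `s`. -/
theorem iSupIndep_flagSpace_line (hA : A ∈ veryGoodUpper d F) (h : ∀ j, v j = ∑ i, A i j • u i)
    (η : Fin 3) (c : ℕ) :
    iSupIndep (fun l : {l : Location d // l.1 η = c} => flagSpace u v l.1) := by
  have hlt : ∀ (l : Location d) (i : Fin 3), l.1 i < d + 1 := by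
    intro l i
    have := l.sum_eq
    fin_cases i <;> simp <;> omega
  have hinj : ∀ θ : Fin 3, θ ≠ η →
      Function.Injective fun l : {l : Location d // l.1 η = c} =>
        (⟨l.1.1 θ, hlt _ _⟩ : Fin (d + 1)) := fun θ hθ l m hlm =>
    Subtype.ext (Location.ext_of_eq (l.2.trans m.2.symm) hθ (by simpa using hlm))
  have hle : ∀ l : Location d, l.1 2 + l.1 1 ≤ d := fun l => by have := l.sum_eq; omega
  have hzero : ∀ x, v.equivFun x = 0 → x = 0 := fun x => (LinearEquiv.map_eq_zero_iff _).1
  by_cases hη : η = 2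
  · subst hη
    refine iSupIndep_of_leading _ (fun k => u.coord k) _ (hinj 1 (by decide))
      (fun l x hx k hk => ?_) fun l x hx hx0 => ?_
    · rw [mem_flagSpace_iff hA h] at hx
      have h1 := hx.2 k hk
      rwa [← equivFun_eq_mulVec h] at h1
    · rw [mem_flagSpace_iff hA h] at hx
      refine hzero x (hx.eq_zero_of_mulVec hA.2 (hle _) ?_)
      rwa [← equivFun_eq_mulVec h]
  · refine iSupIndep_of_leading _ (fun k => v.coord k) _ (hinj 2 (Ne.symm hη))
      (fun l x hx k hk => ?_) fun l x hx hx0 => ?_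
    · rw [mem_flagSpace_iff hA h] at hx
      exact hx.1 k (Or.inl hk)
    · rw [mem_flagSpace_iff hA h] at hx
      exact hzero x (hx.eq_zero hA.2 (hle _) hx0)

/-- The three-term relation of the window system is a nontrivial dependence on the clique. -/
theorem not_iSupIndep_flagSpace_black (hA : A ∈ veryGoodUpper d F)
    (h : ∀ j, v j = ∑ i, A i j • u i) (C : BlackClique d) :
    ¬ iSupIndep (fun i : Fin 3 => flagSpace u v (C.loc i)) := by
  obtain ⟨x, β, hx⟩ := hA.2.exists_isWindowSystem
  have hs := C.sum_eq
  have hmem : ∀ l : Location d, v.equivFun.symm (x (l.1 1) (l.1 2)) ∈ flagSpace u v l := by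
    intro l
    have := l.sum_eq
    rw [mem_flagSpace_iff hA h, LinearEquiv.apply_symm_apply]
    exact hx.isWindowVector _ _ (by omega)
  rw [iSupIndep_iff_finsetSum_eq_zero_imp_eq_zero]
  intro hind
  have h0 := hind Finset.univ
    ![v.equivFun.symm (x (C.base 1) (C.base 2)), -v.equivFun.symm (x (C.base 1 + 1) (C.base 2)),
      β (C.base 1) (C.base 2) • v.equivFun.symm (x (C.base 1) (C.base 2 + 1))]
    (by
      intro i _
      fin_cases i
      · exact hmem (C.loc 0)
      · exact neg_mem (hmem (C.loc 1))
      · exact Submodule.smul_mem _ _ (hmem (C.loc 2)))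
    (by
      rw [Fin.sum_univ_three]
      simp only [cons_val]
      rw [hx.rel _ _ (by omega), map_add, map_smul]
      abel) 0 (Finset.mem_univ _)
  simp only [cons_val, LinearEquiv.map_eq_zero_iff] at h0
  have h1 := hx.apply_eq_one (C.base 1) (C.base 2) (by omega)
  rw [h0] at h1
  exact zero_ne_one h1

/-- The Billiard Array of two bases related by a very good upper triangular matrix. -/
noncomputable def arrayOfBases (hA : A ∈ veryGoodUpper d F) (h : ∀ j, v j = ∑ i, A i j • u i) :
    BilliardArray F d V where
  space := flagSpace u v
  finrank_space := finrank_flagSpace hA h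
  direct_line := iSupIndep_flagSpace_line hA h
  not_direct_black := not_iSupIndep_flagSpace_black hA h

theorem BilliardArray.Isomorphic.refl (B : BilliardArray F d V) : B.Isomorphic B :=
  ⟨LinearEquiv.refl F V, fun _ => Submodule.map_id _⟩

theorem arrayClass_nonempty (hV : Module.finrank F V = d + 1) (hA : A ∈ veryGoodUpper d F) :
    (arrayClass A V).Nonempty := by
  have : Module.Finite F V := Module.finite_of_finrank_pos (by omega)
  let u : Module.Basis (Fin (d + 1)) F V := Module.finBasisOfFinrankEq F V hV
  let w : Fin (d + 1) → V := fun j => ∑ i, A i j • u i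
  have hw : IsUnit (u.det w) := by
    rw [u.det_apply, ← isUnit_iff_isUnit_det]
    convert hA.2.isUnit
    ext i j
    rw [Module.Basis.toMatrix_apply, ← u.equivFun_apply]
    simp only [w, map_sum, map_smul]
    simp [Finsupp.single_apply]
  obtain ⟨h1, h2⟩ := (Module.Basis.is_basis_iff_det u).2 hw
  let v := Module.Basis.mk h1 h2.ge
  have hv : ∀ j, v j = ∑ i, A i j • u i := fun j => Module.Basis.mk_apply h1 h2.ge j
  exact ⟨arrayOfBases hA hv, u, v, arrayOfBases hA hv, hv, fun _ => rfl, .refl _⟩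

end

/-! ### Values of white cliques -/

section

variable {F : Type*} [Field F] {d : ℕ} {V : Type*} [AddCommGroup V] [Module F V]
  {W : Type*} [AddCommGroup W] [Module F W]

theorem BlackClique.formBlackClique (D : BlackClique d) {i j k : Fin 3} (hij : i ≠ j) (hik : i ≠ k)
    (hjk : j ≠ k) : FormBlackClique (D.loc i) (D.loc j) (D.loc k) := by
  have hσ : ∃ σ : Equiv.Perm (Fin 3), σ 0 = i ∧ σ 1 = j ∧ σ 2 = k := by
    revert i j k; decide
  obtain ⟨σ, rfl, rfl, rfl⟩ := hσ
  exact ⟨D, σ, rfl, rfl, rfl⟩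

/-- Nonzero vectors `b s t` in the spaces at the locations `(d - s - t, s, t)` of a
Billiard Array, with three-term relations of coefficients `β s t` on the black cliques. -/
structure IsNormalizedFrame (B : BilliardArray F d V) (b : ℕ → ℕ → V) (β : ℕ → ℕ → F) : Prop where
  mem : ∀ l : Location d, b (l.1 1) (l.1 2) ∈ B.space l
  ne_zero : ∀ s t, t + s ≤ d → b s t ≠ 0
  coeff_ne_zero : ∀ s t, t + s < d → β s t ≠ 0
  rel : ∀ s t, t + s < d → b (s + 1) t = b s t + β s t • b s (t + 1)

namespace IsNormalizedFrame

variable {B : BilliardArray F d V} {b : ℕ → ℕ → V} {β : ℕ → ℕ → F}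

/-- Each edge of a white clique lies in a black clique `D`, whose base is that of `C` with one
coordinate raised. The brace is the three-term relation of `D`, solved for the vector at the third
location. Signs and scalars make the three braces compose up to a factor. -/
theorem isBrace_one (hb : IsNormalizedFrame B b β) (C : WhiteClique d) :
    B.IsBrace (C.loc 0) (C.loc 1) (b (C.base 1 + 1) (C.base 2 + 1))
      (-b (C.base 1) (C.base 2 + 1)) := by
  have hs := C.sum_eq
  let D : BlackClique d := ⟨fun a => if a = 2 then C.base a + 1 else C.base a, by
    rw [Fin.sum_univ_three]; simp; omega⟩
  have h0 : C.loc 0 = D.loc 1 := Location.ext_of_eq (η := 0) (θ := 1)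
    (by simp [D, WhiteClique.loc, BlackClique.loc]) (by decide)
    (by simp [D, WhiteClique.loc, BlackClique.loc])
  have h1 : C.loc 1 = D.loc 0 := Location.ext_of_eq (η := 0) (θ := 1)
    (by simp [D, WhiteClique.loc, BlackClique.loc]) (by decide)
    (by simp [D, WhiteClique.loc, BlackClique.loc])
  refine ⟨hb.mem (C.loc 0), neg_mem (hb.mem (C.loc 1)), hb.ne_zero _ _ (by omega),
    neg_ne_zero.2 (hb.ne_zero _ _ (by omega)), D.loc 2, ?_, ?_⟩
  · rw [h0, h1]
    exact D.formBlackClique (by decide) (by decide) (by decide)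
  · rw [hb.rel _ _ (by omega), add_assoc, add_comm, neg_add_cancel_right]
    exact Submodule.smul_mem _ _ (hb.mem (D.loc 2))

theorem isBrace_two (hb : IsNormalizedFrame B b β) (C : WhiteClique d) :
    B.IsBrace (C.loc 1) (C.loc 2) (-b (C.base 1) (C.base 2 + 1))
      ((β (C.base 1) (C.base 2))⁻¹ • b (C.base 1 + 1) (C.base 2)) := by
  have hs := C.sum_eq
  have hβ := hb.coeff_ne_zero (C.base 1) (C.base 2) (by omega)
  let D : BlackClique d := ⟨fun a => if a = 0 then C.base a + 1 else C.base a, by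
    rw [Fin.sum_univ_three]; simp; omega⟩
  have h0 : C.loc 1 = D.loc 2 := Location.ext_of_eq (η := 0) (θ := 1)
    (by simp [D, WhiteClique.loc, BlackClique.loc]) (by decide)
    (by simp [D, WhiteClique.loc, BlackClique.loc])
  have h1 : C.loc 2 = D.loc 1 := Location.ext_of_eq (η := 0) (θ := 1)
    (by simp [D, WhiteClique.loc, BlackClique.loc]) (by decide)
    (by simp [D, WhiteClique.loc, BlackClique.loc])
  refine ⟨neg_mem (hb.mem (C.loc 1)), Submodule.smul_mem _ _ (hb.mem (C.loc 2)),
    neg_ne_zero.2 (hb.ne_zero _ _ (by omega)),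
    smul_ne_zero (inv_ne_zero hβ) (hb.ne_zero _ _ (by omega)), D.loc 0, ?_, ?_⟩
  · rw [h0, h1]
    exact D.formBlackClique (by decide) (by decide) (by decide)
  · rw [hb.rel _ _ (by omega), smul_add, smul_smul, inv_mul_cancel₀ hβ, one_smul, add_comm,
      add_neg_cancel_right]
    exact Submodule.smul_mem _ _ (hb.mem (D.loc 0))

theorem isBrace_three (hb : IsNormalizedFrame B b β) (C : WhiteClique d) :
    B.IsBrace (C.loc 2) (C.loc 0) (b (C.base 1 + 1) (C.base 2))
      (β (C.base 1 + 1) (C.base 2) • b (C.base 1 + 1) (C.base 2 + 1)) := by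
  have hs := C.sum_eq
  have hβ := hb.coeff_ne_zero (C.base 1 + 1) (C.base 2) (by omega)
  let D : BlackClique d := ⟨fun a => if a = 1 then C.base a + 1 else C.base a, by
    rw [Fin.sum_univ_three]; simp; omega⟩
  have h0 : C.loc 2 = D.loc 0 := Location.ext_of_eq (η := 0) (θ := 1)
    (by simp [D, WhiteClique.loc, BlackClique.loc]) (by decide)
    (by simp [D, WhiteClique.loc, BlackClique.loc])
  have h1 : C.loc 0 = D.loc 2 := Location.ext_of_eq (η := 0) (θ := 1)
    (by simp [D, WhiteClique.loc, BlackClique.loc]) (by decide)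
    (by simp [D, WhiteClique.loc, BlackClique.loc])
  refine ⟨hb.mem (C.loc 2), Submodule.smul_mem _ _ (hb.mem (C.loc 0)), hb.ne_zero _ _ (by omega),
    smul_ne_zero hβ (hb.ne_zero _ _ (by omega)), D.loc 1, ?_, ?_⟩
  · rw [h0, h1]
    exact D.formBlackClique (by decide) (by decide) (by decide)
  · rw [← hb.rel _ _ (by omega)]
    exact hb.mem (D.loc 1)

theorem bValue_eq (hb : IsNormalizedFrame B b β) (C : WhiteClique d) :
    B.bValue C = (β (C.base 1) (C.base 2))⁻¹ * β (C.base 1 + 1) (C.base 2) := by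
  have hs := C.sum_eq
  have hβ := inv_ne_zero (hb.coeff_ne_zero (C.base 1) (C.base 2) (by omega))
  have hB : B.IsBValue C (B.bValue C) := (B.existsUnique_bValue C).choose_spec.1
  have h := hB _ _ _ _ (hb.isBrace_one C) (hb.isBrace_two C) ((hb.isBrace_three C).smul hβ)
  rw [smul_smul] at h
  exact (smul_left_injective F (hb.ne_zero (C.base 1 + 1) (C.base 2 + 1) (by omega)) h).symm

theorem map (hb : IsNormalizedFrame B b β) {B' : BilliardArray F d W} {σ : V ≃ₗ[F] W}
    (hσ : ∀ l, (B.space l).map σ.toLinearMap = B'.space l) :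
    IsNormalizedFrame B' (fun s t => σ (b s t)) β where
  mem l := by
    rw [← hσ l]
    exact Submodule.mem_map_of_mem (hb.mem l)
  ne_zero s t h := by simpa using hb.ne_zero s t h
  coeff_ne_zero := hb.coeff_ne_zero
  rel s t h := by rw [hb.rel s t h, map_add, map_smul]

end IsNormalizedFrame

variable {A : Matrix (Fin (d + 1)) (Fin (d + 1)) F}

open Matrix

/-- A frame keeps its coefficients under isomorphism, so the value can be computed from `A` alone.
-/
theorem IsWindowSystem.bValue_eq {x : ℕ → ℕ → Fin (d + 1) → F} {β : ℕ → ℕ → F}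
    (hx : IsWindowSystem A x β) (hA : A ∈ veryGoodUpper d F) {B : BilliardArray F d V}
    (hB : B ∈ arrayClass A V) (C : WhiteClique d) :
    B.bValue C = (β (C.base 1) (C.base 2))⁻¹ * β (C.base 1 + 1) (C.base 2) := by
  obtain ⟨u, v, B₀, h, hB₀, σ, hσ⟩ := hB
  have hb : IsNormalizedFrame B₀ (fun s t => v.equivFun.symm (x s t)) β := by
    refine ⟨fun l => ?_, fun s t hst => ?_, hx.coeff_ne_zero, fun s t hst => ?_⟩
    · have hl := l.sum_eq
      rw [hB₀ l]
      refine (mem_flagSpace_iff hA h l _).2 ?_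
      rw [LinearEquiv.apply_symm_apply]
      exact hx.isWindowVector _ _ (by omega)
    · rw [Ne, LinearEquiv.map_eq_zero_iff]
      intro h0
      have h1 := hx.apply_eq_one s t hst
      rw [h0] at h1
      exact zero_ne_one h1
    · rw [hx.rel s t hst, map_add, map_smul]
  exact (hb.map hσ).bValue_eq C

/-! ### The window system of the `q`-binomial matrix -/

/-- The standard basis vector of index `n`, or `0` if `n` is out of range. -/
def stdVec (F : Type*) [Field F] (d n : ℕ) : Fin (d + 1) → F :=
  fun k => if (k : ℕ) = n then 1 else 0

theorem mulVec_stdVec (A : Matrix (Fin (d + 1)) (Fin (d + 1)) F) {n : ℕ} (hn : n ≤ d)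
    (i : Fin (d + 1)) : (A *ᵥ stdVec F d n) i = A i ⟨n, by omega⟩ := by
  rw [mulVec, dotProduct, Finset.sum_eq_single ⟨n, by omega⟩]
  · simp [stdVec]
  · intro b _ hb
    have : (b : ℕ) ≠ n := fun h => hb (Fin.ext h)
    simp [stdVec, this]
  · simp

variable {q : F}

theorem qDiff_stdVec_apply (s t : ℕ) (k : Fin (d + 1)) :
    qDiff q (stdVec F d) s t k = qDiff q (fun n => if (k : ℕ) = n then (1 : F) else 0) s t :=
  qDiff_map q (LinearMap.proj k) (stdVec F d) s t

theorem mulVec_qDiff_stdVec (A : Matrix (Fin (d + 1)) (Fin (d + 1)) F) (s t : ℕ)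
    (i : Fin (d + 1)) :
    (A *ᵥ qDiff q (stdVec F d) s t) i = qDiff q (fun n => (A *ᵥ stdVec F d n) i) s t :=
  qDiff_map q (LinearMap.proj i ∘ₗ A.mulVecLin) (stdVec F d) s t

theorem qDiff_zero (s t : ℕ) : qDiff q (fun _ => (0 : F)) s t = 0 := by
  induction s generalizing t with
  | zero => rfl
  | succ s ih => simp [qDiff, ih]

theorem qDiff_qBinomialMatrix (hq : q ≠ 0) {s t : ℕ} (hst : t + s ≤ d) (i : Fin (d + 1))
    (hi : (i : ℕ) < s) :
    qDiff q (fun n => (qBinomialMatrix q d *ᵥ stdVec F d n) i) s t = 0 := by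
  rw [← qDiff_qBinomial_of_lt hq hi t]
  refine qDiff_congr q fun n _ hn => ?_
  rw [mulVec_stdVec _ (by omega)]
  rfl

theorem isWindowSystem_qBinomialMatrix (hq : q ≠ 0) (d : ℕ) :
    IsWindowSystem (qBinomialMatrix q d) (qDiff q (stdVec F d)) fun s _ => -q⁻¹ ^ s where
  isWindowVector s t hst := by
    refine ⟨fun k hk => ?_, fun i hi => ?_⟩
    · rw [qDiff_stdVec_apply, qDiff_congr q (g := fun _ => (0 : F)), qDiff_zero]
      exact fun n h1 h2 => if_neg (by omega)
    · rw [mulVec_qDiff_stdVec, qDiff_qBinomialMatrix hq hst i hi]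
  apply_eq_one s t hst := by
    rw [qDiff_stdVec_apply]
    induction s with
    | zero => simp [qDiff]
    | succ s ih =>
      -- The subtracted difference starts at `t + 1` and so has no coordinate at `t`.
      rw [qDiff, ih (by omega), sub_eq_self]
      rw [qDiff_congr q (g := fun _ => (0 : F)), qDiff_zero, smul_zero]
      exact fun n h1 h2 => if_neg (by simp; omega)
  coeff_ne_zero s t _ := neg_ne_zero.2 (pow_ne_zero _ (inv_ne_zero hq))
  rel s t _ := by rw [qDiff, neg_smul, sub_eq_add_neg]

/-! ### Uniqueness -/

theorem IsWindowSystem.eq_qDiff {x : ℕ → ℕ → Fin (d + 1) → F} {β : ℕ → ℕ → F}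
    (hx : IsWindowSystem A x β) (hβ : ∀ s t, t + s < d → β s t = -q⁻¹ ^ s) :
    ∀ s t, t + s ≤ d → x s t = qDiff q (stdVec F d) s t := by
  intro s
  induction s with
  | zero =>
    intro t ht
    ext k
    by_cases hk : (k : ℕ) = t
    · rw [show k = ⟨t, by omega⟩ from Fin.ext hk, hx.apply_eq_one 0 t ht]
      simp [qDiff, stdVec]
    · rw [(hx.isWindowVector 0 t ht).1 k (by omega)]
      simp [qDiff, stdVec, hk]
  | succ s ih =>
    intro t ht
    rw [hx.rel s t (by omega), hβ s t (by omega), ih t (by omega), ih (t + 1) (by omega), qDiff,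
      neg_smul, sub_eq_add_neg]

/-- Row `0` is constantly `1` and must annihilate `x 1 t = e_t + β 0 t • e_(t+1)`. -/
theorem IsWindowSystem.coeff_zero {x : ℕ → ℕ → Fin (d + 1) → F} {β : ℕ → ℕ → F}
    (hx : IsWindowSystem A x β) (hA : IsNice A) {t : ℕ} (ht : t < d) : β 0 t = -1 := by
  have h0 : ∀ t (ht : t ≤ d), (A *ᵥ x 0 t) 0 = 1 := by
    intro t ht
    rw [mulVec, dotProduct, Finset.sum_eq_single ⟨t, by omega⟩, hx.apply_eq_one 0 t ht, mul_one]
    · exact (hA _).1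
    · intro b _ hb
      have : (b : ℕ) ≠ t := fun h => hb (Fin.ext h)
      rw [(hx.isWindowVector 0 t ht).1 b (by omega), mul_zero]
    · simp
  have h1 := (hx.isWindowVector 1 t ht).2 0 (by simp)
  rw [hx.rel 0 t ht, mulVec_add, mulVec_smul, Pi.add_apply, Pi.smul_apply, h0 t ht.le,
    h0 (t + 1) ht, smul_eq_mul, mul_one] at h1
  exact eq_neg_of_add_eq_zero_right h1

theorem IsWindowSystem.coeff_eq {x : ℕ → ℕ → Fin (d + 1) → F} {β : ℕ → ℕ → F}
    (hx : IsWindowSystem A x β) (hA : IsNice A)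
    (h : ∀ C : WhiteClique d, (β (C.base 1) (C.base 2))⁻¹ * β (C.base 1 + 1) (C.base 2) = q⁻¹) :
    ∀ s t, t + s < d → β s t = -q⁻¹ ^ s := by
  intro s
  induction s with
  | zero => exact fun t (ht : t < d) => by rw [hx.coeff_zero hA ht, pow_zero]
  | succ s ih =>
    intro t ht
    -- The bound `t + (s + 1) < d` makes the subtraction exact, so this white clique exists.
    have h1 := h ⟨![d - 2 - s - t, s, t], by rw [Fin.sum_univ_three]; simp; omega⟩
    simp only [cons_val] at h1
    rw [inv_mul_eq_iff_eq_mul₀ (hx.coeff_ne_zero s t (by omega)), ih t (by omega)] at h1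
    rw [h1, pow_succ, neg_mul]

theorem eq_qBinomialMatrix (hq : q ≠ 0) (hA : A ∈ veryGoodUpper d F) (hA' : IsNice A)
    {x : ℕ → ℕ → Fin (d + 1) → F} (hx : IsWindowSystem A x fun s _ => -q⁻¹ ^ s) :
    A = qBinomialMatrix q d := by
  have hT := qBinomialMatrix_mem_veryGoodUpper q hq d
  have hT' := isNice_qBinomialMatrix q d
  have hxq := hx.eq_qDiff (q := q) fun _ _ _ => rfl
  ext i j
  have hz : ∀ n ≤ d,
      (A *ᵥ stdVec F d n) i - (qBinomialMatrix q d *ᵥ stdVec F d n) i = 0 := by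
    -- Columns `0, …, i` of row `i` are prescribed, and differences of order `i + 1` kill the row in
    -- both matrices.
    refine eq_zero_of_qDiff_eq_zero (s := (i : ℕ) + 1) hq (fun n hn => ?_) fun t ht => ?_
    · rw [mulVec_stdVec _ (by omega), mulVec_stdVec _ (by omega)]
      rcases Nat.lt_succ_iff_lt_or_eq.1 hn with hn | rfl
      · rw [hA.1 (show id (⟨n, by omega⟩ : Fin (d + 1)) < id i from hn),
          hT.1 (show id (⟨n, by omega⟩ : Fin (d + 1)) < id i from hn), sub_self]
      · rw [Fin.eta, (hA' i).2, (hT' i).2, sub_self]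
    · rw [qDiff_sub, qDiff_qBinomialMatrix hq ht i (by omega), ← mulVec_qDiff_stdVec,
        ← hxq _ _ ht, (hx.isWindowVector _ _ ht).2 i (by omega), sub_self]
  have h := hz j (by omega)
  rw [mulVec_stdVec _ (by omega), mulVec_stdVec _ (by omega), sub_eq_zero] at h
  exact h

end

theorem proposition9p10 {F : Type*} [Field F] (q : F) (hq : q ≠ 0) (d : ℕ) (hd : 2 ≤ d)
    (V : Type*) [AddCommGroup V] [Module F V] (hV : Module.finrank F V = d + 1) :
    -- the determinants of the submatrices `T[i,j]`
    (∀ (i j : ℕ) (hij : i ≤ j) (hj : j ≤ d),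
      (cornerSubmatrix (qBinomialMatrix q d) i j hij hj).det =
        q ^ (i * (j - i) * (j - i + 1) / 2)) ∧
    -- `T` is upper triangular, very good and nice
    qBinomialMatrix q d ∈ veryGoodUpper d F ∧
    IsNice (qBinomialMatrix q d) ∧
    -- very good upper triangular matrices do have associated Billiard Arrays on `V`
    (∀ A ∈ veryGoodUpper d F, (arrayClass A V).Nonempty) ∧
    -- all `B`-values of each Billiard Array associated with `T` are equal to `q⁻¹`
    (∀ B ∈ arrayClass (qBinomialMatrix q d) V, ∀ C : WhiteClique d, B.bValue C = q⁻¹) ∧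
    -- and `T` is the only nice very good upper triangular matrix with this property
    (∀ A ∈ veryGoodUpper d F, IsNice A →
      (∃ B ∈ arrayClass A V, ∀ C : WhiteClique d, B.bValue C = q⁻¹) →
      A = qBinomialMatrix q d) := by
  have hT := qBinomialMatrix_mem_veryGoodUpper q hq d
  refine ⟨fun i j => det_cornerSubmatrix_qBinomialMatrix q, hT, isNice_qBinomialMatrix q d,
    fun A hA => arrayClass_nonempty hV hA, fun B hB C => ?_, ?_⟩
  · rw [(isWindowSystem_qBinomialMatrix hq d).bValue_eq hT hB C, pow_succ, inv_neg, neg_mul_neg,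
      inv_mul_cancel_left₀ (pow_ne_zero _ (inv_ne_zero hq))]
  · rintro A hA hA' ⟨B, hB, h⟩
    obtain ⟨x, β, hx⟩ := hA.2.exists_isWindowSystem
    have hβ := hx.coeff_eq hA' fun C => (hx.bValue_eq hA hB C).symm.trans (h C)
    -- The function `β` is arbitrary outside the triangle `t + s < d`, so it is replaced by the
    -- closed formula.
    refine eq_qBinomialMatrix hq hA hA' (x := x) ⟨hx.isWindowVector, hx.apply_eq_one,
      (isWindowSystem_qBinomialMatrix hq d).coeff_ne_zero, fun s t hst => ?_⟩
    rw [hx.rel s t hst, hβ s t hst]
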